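/- **Theorem 4.7.** Let $N\ge 1$ and let $u_0\in C(\mathbb R^N)$ be a convex function satisfying, for some constants $A,B>0$, $$u_0(x)\le A\,e^{B|x|^2}\qquad\text{for all }x\in\mathbb R^N .$$ Set $T=\frac1{4B}$ and let $u$ be the canonical solution of the heat equation $u_t=\Delta u$ with initial datum $u_0$, that is, $u(x,0)=u_0(x)$ and $$u(x,t)=\frac1{(4\pi t)^{N/2}}\int_{\mathbb R^N}u_0(y)\,e^{-\frac{|x-y|^2}{4t}}\,dy\qquad\text{for all }(x,t)\in\mathbb R^N\times(0,T),$$ where the integral converges absolutely. For $\xi\in\mathbb R^N\setminus\{0\}$, call a function $v\in C(\mathbb R^N)$ $\xi$-ruled if $2v(x)-v(x+\mu\xi)-v(x-\mu\xi)=0$ for all $x\in\mathbb R^N$ and $\mu\in\mathbb R$. Then: 1. $u(\cdot,t)$ is convex for all $t\in(0,T)$. 2. If $u_0$ is $\xi$-ruled for some $\xi\in\mathbb R^N\setminus\{0\}$, then $u(\cdot,t)$ is $\xi$-ruled (for the same $\xi$) for all $t\in(0,T)$; otherwise $u(\cdot,t)$ is strictly convex for all $t\in(0,T)$. 3. The derivative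 $u_t(x,t)$ exists and $u_t(x,t)\ge 0$ for all $(x,t)\in\mathbb R^N\times(0,T)$. Moreover, $u_t(x_0,t_0)=0$ at some $(x_0,t_0)\in\mathbb R^N\times(0,T)$ if and only if $u_0$ is affine and $u(x,t)=u_0(x)$ for all $(x,t)\in\mathbb R^N\times(0,T)$. -/

import Mathlib

open MeasureTheory Set

/-- The classical heat kernel `K(x,t) = (4πt)^(-N/2) exp(-|x|²/(4t))` on `ℝ^N`. -/
noncomputable def heatKernel {N : ℕ} (x : EuclideanSpace ℝ (Fin N)) (t : ℝ) : ℝ :=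
  1 / (4 * Real.pi * t) ^ ((N : ℝ) / 2) * Real.exp (-‖x‖ ^ 2 / (4 * t))

/-- The canonical solution of the heat equation with initial datum `u₀`: it is `u₀` at `t = 0`,
and the convolution of `u₀` with the heat kernel at positive times. -/
noncomputable def canonicalSolution {N : ℕ} (u₀ : EuclideanSpace ℝ (Fin N) → ℝ)
    (x : EuclideanSpace ℝ (Fin N)) (t : ℝ) : ℝ :=
  if t = 0 then u₀ x else ∫ y, u₀ y * heatKernel (x - y) t

/-- `v` is `ξ`-ruled: its graph consists of straight lines whose projections onto `ℝ^N` have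
direction `ξ`. -/
def IsRuled {N : ℕ} (ξ : EuclideanSpace ℝ (Fin N)) (v : EuclideanSpace ℝ (Fin N) → ℝ) : Prop :=
  ∀ (x : EuclideanSpace ℝ (Fin N)) (μ : ℝ), 2 * v x - v (x + μ • ξ) - v (x - μ • ξ) = 0

/-- `v` is an affine function on `ℝ^N`. -/
def IsAffine {N : ℕ} (v : EuclideanSpace ℝ (Fin N) → ℝ) : Prop :=
  ∃ (a : EuclideanSpace ℝ (Fin N)) (b : ℝ), ∀ x, v x = inner ℝ a x + b

/-! The canonical solution averages translates of the datum against a positive kernel, so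
inequalities for the datum pass to the solution, and equality at one point is rigid.

Space: the Jensen gap of the solution is the heat average of the gap `a * f (x + w) + b * f (y + w)
- f (a • x + b • y + w)`, continuous and nonnegative in `w`. If the average vanishes, so does the
gap for every `w`; this is Jensen's equality along `x - y` at all base points, and it forces the
datum to be ruled in that direction.

Time: the increment from the datum at `x` is the heat average of `g w = (f (x + w) + f (x - w)) / 2
- f x`. As `g` is convex with `g 0 = 0`, `g (s • w) ≥ s * g w` for `s ≥ 1`. Parabolic scaling turns
this into growth in time, and differentiating at `s = 1` gives `2 * t * u_t ≥ u - f ≥ 0`. A zero of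
`u_t` therefore kills `g`, and the datum is affine. No maximum principle is needed. -/

open Filter Topology

/-! ### Rigidity and growth of convex functions. -/

section ConvexFunctions

/-- A convex function on the line has a supporting line at every point. -/
theorem ConvexOn.exists_supporting_slope {f : ℝ → ℝ} (hf : ConvexOn ℝ univ f) (s : ℝ) :
    ∃ c, ∀ y, f s + c * (y - s) ≤ f y := by
  refine ⟨derivWithin f (Ioi s) s, fun y => ?_⟩
  have hs : s ∈ interior (univ : Set ℝ) := by simp
  rcases lt_trichotomy y s with h | rfl | h
  · have h1 := (hf.slope_le_leftDeriv_of_mem_interior (mem_univ y) hs h).trans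
      (hf.leftDeriv_le_rightDeriv_of_mem_interior hs)
    rw [slope_def_field, div_le_iff₀ (by linarith)] at h1
    linarith
  · simp
  · have h1 := hf.rightDeriv_le_slope_of_mem_interior hs (mem_univ y) h
    rw [slope_def_field, le_div_iff₀ (by linarith)] at h1
    linarith

/-- A convex function on the line satisfying Jensen's equality at every point, with fixed weights
and increments, is affine. -/
theorem ConvexOn.exists_eq_affine_of_jensen_eq {f : ℝ → ℝ} (hf : ConvexOn ℝ univ f) {a b : ℝ}
    (ha : 0 < a) (hb : 0 < b) (hab : a + b = 1)
    (h : ∀ s, a * f (s + b) + b * f (s - a) = f s) :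
    ∃ c, ∀ s, f s = f 0 + c * s := by
  obtain ⟨c, hc⟩ := hf.exists_supporting_slope 0
  refine ⟨c, ?_⟩
  -- Both deviations from the supporting line are nonnegative and their weighted sum is zero, so
  -- contact with the line propagates from `s` to `s + b` and `s - a`.
  have hstep : ∀ s, f s = f 0 + c * s →
      f (s + b) = f 0 + c * (s + b) ∧ f (s - a) = f 0 + c * (s - a) := by
    intro s hs
    have h1 := hc (s + b)
    have h2 := hc (s - a)
    have h3 := h s
    have h4 : a * (f (s + b) - (f 0 + c * (s + b))) + b * (f (s - a) - (f 0 + c * (s - a))) = 0 := by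
      have : b = 1 - a := by linarith
      subst this
      linear_combination h3 + hs
    have h5 : 0 ≤ a * (f (s + b) - (f 0 + c * (s + b))) := mul_nonneg ha.le (by linarith)
    have h6 : 0 ≤ b * (f (s - a) - (f 0 + c * (s - a))) := mul_nonneg hb.le (by linarith)
    have h7 : a * (f (s + b) - (f 0 + c * (s + b))) = 0 := by linarith
    have h8 : b * (f (s - a) - (f 0 + c * (s - a))) = 0 := by linarith
    rw [mul_eq_zero] at h7 h8
    constructor
    · rcases h7 with h7 | h7 <;> linarith
    · rcases h8 with h8 | h8 <;> linarith
  have hup : ∀ n : ℕ, f (n * b) = f 0 + c * (n * b) := by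
    intro n
    induction n with
    | zero => simp
    | succ k ih =>
      have := (hstep _ ih).1
      rw [show ((k + 1 : ℕ) : ℝ) * b = k * b + b by push_cast; ring]
      exact this
  have hdown : ∀ n : ℕ, f (-(n * a)) = f 0 + c * (-(n * a)) := by
    intro n
    induction n with
    | zero => simp
    | succ k ih =>
      have := (hstep _ ih).2
      rw [show -(((k + 1 : ℕ) : ℝ) * a) = -(k * a) - a by push_cast; ring]
      exact this
  intro s
  refine le_antisymm ?_ (by simpa using hc s)
  -- Contact points exist arbitrarily far out on both sides; the chord between two of them around
  -- `s` lies on the line and bounds `f s` from above.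
  obtain ⟨m, hm⟩ := exists_nat_gt (s / b)
  obtain ⟨n, hn⟩ := exists_nat_gt (-s / a)
  rw [div_lt_iff₀ hb] at hm
  rw [div_lt_iff₀ ha] at hn
  set p := (m : ℝ) * b
  set q := (n : ℝ) * a
  have hpq : 0 < p + q := by linarith
  have hj := hf.2 (mem_univ (-q)) (mem_univ p)
    (show 0 ≤ (p - s) / (p + q) from div_nonneg (by linarith) hpq.le)
    (show 0 ≤ (s + q) / (p + q) from div_nonneg (by linarith) hpq.le)
    (by field_simp; ring)
  simp only [smul_eq_mul] at hj
  rw [hup m, hdown n, show (p - s) / (p + q) * -q + (s + q) / (p + q) * p = s by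
    field_simp; ring] at hj
  refine hj.trans_eq ?_
  field_simp
  ring

variable {N : ℕ}

local notation "𝔼" => EuclideanSpace ℝ (Fin N)

/-- A convex function satisfying Jensen's equality in direction `ξ` at every point, with fixed
weights, is `ξ`-ruled. -/
theorem ConvexOn.isRuled_of_jensen_eq {v : 𝔼 → ℝ} (hv : ConvexOn ℝ univ v) {ξ : 𝔼} {a b : ℝ}
    (ha : 0 < a) (hb : 0 < b) (hab : a + b = 1)
    (h : ∀ p, a * v (p + b • ξ) + b * v (p - a • ξ) = v p) : IsRuled ξ v := by
  intro x μ
  have hf : ConvexOn ℝ univ (fun s : ℝ => v (x + s • ξ)) := by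
    have := hv.comp_affineMap (AffineMap.lineMap x (x + ξ) : ℝ →ᵃ[ℝ] 𝔼)
    simpa [Function.comp_def, AffineMap.lineMap_apply, add_comm] using this
  obtain ⟨c, hc⟩ := hf.exists_eq_affine_of_jensen_eq ha hb hab fun s => by
    have := h (x + s • ξ)
    simpa only [add_smul, sub_smul, add_assoc, add_sub_assoc] using this
  have h1 := hc μ
  have h2 := hc (-μ)
  simp only [zero_smul, add_zero, neg_smul, ← sub_eq_add_neg] at h1 h2
  linarith

/-- A continuous convex function which is symmetric about a point of its graph is affine. -/
theorem ConvexOn.isAffine_of_symm {v : 𝔼 → ℝ} (hc : Continuous v) (hv : ConvexOn ℝ univ v) {x : 𝔼}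
    (h : ∀ z, v (x + z) + v (x - z) = 2 * v x) : IsAffine v := by
  set w : 𝔼 → ℝ := fun z => v (x + z) - v x with hw
  have hodd : ∀ z, w (-z) = -w z := fun z => by
    have := h z
    simp only [hw, ← sub_eq_add_neg]
    linarith
  have hle : ∀ p q, w ((1 / 2 : ℝ) • p + (1 / 2 : ℝ) • q) ≤ 1 / 2 * w p + 1 / 2 * w q := by
    intro p q
    have := hv.2 (mem_univ (x + p)) (mem_univ (x + q)) (by norm_num : (0 : ℝ) ≤ 1 / 2)
      (by norm_num : (0 : ℝ) ≤ 1 / 2) (by norm_num)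
    rw [show (1 / 2 : ℝ) • (x + p) + (1 / 2 : ℝ) • (x + q)
      = x + ((1 / 2 : ℝ) • p + (1 / 2 : ℝ) • q) by module] at this
    simp only [smul_eq_mul] at this
    simp only [hw]
    linarith
  have hmid : ∀ p q, w ((1 / 2 : ℝ) • p + (1 / 2 : ℝ) • q) = 1 / 2 * w p + 1 / 2 * w q := by
    intro p q
    refine le_antisymm (hle p q) ?_
    have := hle (-p) (-q)
    rw [show (1 / 2 : ℝ) • -p + (1 / 2 : ℝ) • -q = -((1 / 2 : ℝ) • p + (1 / 2 : ℝ) • q) by module,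
      hodd, hodd, hodd] at this
    linarith
  have h0 : w 0 = 0 := by simp [hw]
  have hhalf : ∀ p, w ((1 / 2 : ℝ) • p) = 1 / 2 * w p := fun p => by
    have := hmid p 0
    simpa [h0] using this
  have hadd : ∀ p q, w (p + q) = w p + w q := fun p q => by
    have h1 := hmid p q
    rw [← smul_add, hhalf] at h1
    linarith
  have hwc : Continuous w := by fun_prop
  let L : 𝔼 →L[ℝ] ℝ := (AddMonoidHom.mk' w hadd).toRealLinearMap hwc
  have hL : ∀ z, L z = w z := fun z => rfl
  refine ⟨(InnerProductSpace.toDual ℝ 𝔼).symm L, v x - w x, fun y => ?_⟩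
  rw [InnerProductSpace.toDual_symm_apply, hL]
  have h1 : w y = w (y - x) + w x := by rw [← hadd]; simp
  have h2 : w (y - x) = v y - v x := by simp [hw]
  linarith

/-- A convex function with a Gaussian upper bound is bounded in absolute value by a Gaussian. -/
theorem ConvexOn.abs_le_of_le_exp {v : 𝔼 → ℝ} (hv : ConvexOn ℝ univ v) {A B : ℝ}
    (hB : 0 ≤ B) (h : ∀ x, v x ≤ A * Real.exp (B * ‖x‖ ^ 2)) (x : 𝔼) :
    |v x| ≤ (2 * |v 0| + A) * Real.exp (B * ‖x‖ ^ 2) := by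
  have h1 := hv.2 (mem_univ x) (mem_univ (-x)) (by norm_num : (0 : ℝ) ≤ 1 / 2)
      (by norm_num : (0 : ℝ) ≤ 1 / 2) (by norm_num)
  rw [show (1 / 2 : ℝ) • x + (1 / 2 : ℝ) • -x = 0 by module] at h1
  simp only [smul_eq_mul] at h1
  have h2 := h x
  have h3 := h (-x)
  rw [norm_neg] at h3
  have h4 : 1 ≤ Real.exp (B * ‖x‖ ^ 2) := Real.one_le_exp (by positivity)
  have h5 : 2 * |v 0| ≤ 2 * |v 0| * Real.exp (B * ‖x‖ ^ 2) :=
    le_mul_of_one_le_right (by positivity) h4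
  have h6 := neg_abs_le (v 0)
  have h7 := abs_nonneg (v 0)
  rw [abs_le]
  constructor <;> linarith

end ConvexFunctions

/-! ### The heat kernel: normalisation, scaling, Gaussian domination, differentiation in time. -/

section HeatKernel

variable {N : ℕ}

local notation "𝔼" => EuclideanSpace ℝ (Fin N)

theorem integrable_exp_neg_mul_sq_norm {b : ℝ} (hb : 0 < b) :
    Integrable (fun v : 𝔼 => Real.exp (-b * ‖v‖ ^ 2)) := by
  -- The integral of a non-integrable function is `0` by convention, so a nonzero value proves
  -- integrability.
  apply Integrable.of_integral_ne_zero
  rw [GaussianFourier.integral_rexp_neg_mul_sq_norm hb]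
  positivity

theorem heatKernel_pos {t : ℝ} (ht : 0 < t) (x : 𝔼) : 0 < heatKernel x t := by
  unfold heatKernel
  positivity

theorem heatKernel_neg (x : 𝔼) (t : ℝ) : heatKernel (-x) t = heatKernel x t := by
  simp [heatKernel]

theorem heatKernel_eq (x : 𝔼) (t : ℝ) : heatKernel x t =
    1 / (4 * Real.pi * t) ^ ((N : ℝ) / 2) * Real.exp (-(1 / (4 * t)) * ‖x‖ ^ 2) := by
  unfold heatKernel
  congr 2
  ring

theorem integral_heatKernel {t : ℝ} (ht : 0 < t) : ∫ x : 𝔼, heatKernel x t = 1 := by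
  simp_rw [heatKernel_eq]
  rw [integral_const_mul, GaussianFourier.integral_rexp_neg_mul_sq_norm (by positivity),
    finrank_euclideanSpace_fin, show Real.pi / (1 / (4 * t)) = 4 * Real.pi * t by field_simp]
  have : 0 < (4 * Real.pi * t) ^ ((N : ℝ) / 2) := by positivity
  field_simp

theorem integrable_heatKernel {t : ℝ} (ht : 0 < t) :
    Integrable (fun x : 𝔼 => heatKernel x t) :=
  Integrable.of_integral_ne_zero (by simp [integral_heatKernel ht])

theorem heatKernel_smul {s t : ℝ} (hs : 0 < s) (ht : 0 < t) (x : 𝔼) :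
    heatKernel (s • x) (t * s ^ 2) = (s ^ N)⁻¹ * heatKernel x t := by
  unfold heatKernel
  rw [norm_smul, Real.norm_of_nonneg hs.le, mul_pow,
    show -(s ^ 2 * ‖x‖ ^ 2) / (4 * (t * s ^ 2)) = -‖x‖ ^ 2 / (4 * t) by field_simp,
    show 4 * Real.pi * (t * s ^ 2) = 4 * Real.pi * t * s ^ 2 by ring,
    Real.mul_rpow (by positivity) (by positivity), ← Real.rpow_natCast s 2, ← Real.rpow_mul hs.le,
    show ((2 : ℕ) : ℝ) * ((N : ℝ) / 2) = N by push_cast; ring, Real.rpow_natCast]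
  have : 0 < (4 * Real.pi * t) ^ ((N : ℝ) / 2) := by positivity
  field_simp

/-- Parabolic scaling of convolution with the heat kernel. -/
theorem integral_mul_heatKernel_scale (f : 𝔼 → ℝ) {s t : ℝ} (hs : 0 < s) (ht : 0 < t) :
    ∫ w, f w * heatKernel w (t * s ^ 2) = ∫ w, f (s • w) * heatKernel w t := by
  have h := Measure.integral_comp_smul_of_nonneg (volume : Measure 𝔼)
    (fun w => f w * heatKernel w (t * s ^ 2)) s (hR := hs.le)
  simp only [heatKernel_smul hs ht, finrank_euclideanSpace_fin, smul_eq_mul] at h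
  have hs' : (s ^ N)⁻¹ ≠ 0 := by positivity
  rw [← mul_right_inj' hs', ← h, ← integral_const_mul]
  congr 1
  ext w
  ring

theorem integrable_mul_heatKernel_scale {f : 𝔼 → ℝ} {s t : ℝ} (hs : 0 < s) (ht : 0 < t)
    (h : Integrable fun w => f w * heatKernel w (t * s ^ 2)) :
    Integrable fun w => f (s • w) * heatKernel w t := by
  have h1 := ((integrable_comp_smul_iff (volume : Measure 𝔼) _ hs.ne').2 h).const_mul (s ^ N)
  simp only [heatKernel_smul hs ht] at h1
  refine h1.congr (Eventually.of_forall fun w => ?_)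
  have : s ^ N ≠ 0 := by positivity
  field_simp

theorem canonicalSolution_eq_integral_add (f : 𝔼 → ℝ) (x : 𝔼) {t : ℝ} (ht : 0 < t) :
    canonicalSolution f x t = ∫ w, f (x + w) * heatKernel w t := by
  rw [canonicalSolution, if_neg ht.ne', ← integral_add_left_eq_self _ x]
  congr 1
  ext w
  rw [← heatKernel_neg w]
  congr 2
  abel

theorem canonicalSolution_eq_integral_sub (f : 𝔼 → ℝ) (x : 𝔼) {t : ℝ} (ht : 0 < t) :
    canonicalSolution f x t = ∫ w, f (x - w) * heatKernel w t := by
  rw [canonicalSolution, if_neg ht.ne', ← integral_sub_left_eq_self _ _ x]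
  simp

theorem integrable_mul_exp_neg_mul_sq_norm_sub {f : 𝔼 → ℝ} (hf : Continuous f) {B C κ : ℝ} (hB : 0 < B)
    (hC : 0 ≤ C) (hfb : ∀ y, |f y| ≤ C * Real.exp (B * ‖y‖ ^ 2)) (hκ : B < κ) (x : 𝔼) :
    Integrable fun y => f y * Real.exp (-κ * ‖x - y‖ ^ 2) := by
  set δ := κ - B with hδ
  have hδ0 : 0 < δ := by linarith
  have hg := ((integrable_exp_neg_mul_sq_norm (N := N) (half_pos hδ0)).comp_sub_left x).const_mul
    (C * Real.exp ((2 * B ^ 2 / δ + B) * ‖x‖ ^ 2))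
  refine hg.mono' (by fun_prop) (Eventually.of_forall fun y => ?_)
  rw [norm_mul, Real.norm_eq_abs, Real.norm_of_nonneg (Real.exp_pos _).le]
  calc |f y| * Real.exp (-κ * ‖x - y‖ ^ 2)
      ≤ C * Real.exp (B * ‖y‖ ^ 2) * Real.exp (-κ * ‖x - y‖ ^ 2) := by gcongr; exact hfb y
    _ = C * Real.exp (B * ‖y‖ ^ 2 + -κ * ‖x - y‖ ^ 2) := by rw [Real.exp_add]; ring
    _ ≤ C * Real.exp ((2 * B ^ 2 / δ + B) * ‖x‖ ^ 2 + -(δ / 2) * ‖x - y‖ ^ 2) := by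
        gcongr C * Real.exp ?_
        have hy : ‖y‖ ≤ ‖x‖ + ‖x - y‖ := by
          have := norm_sub_le x (x - y)
          simpa using this
        set p := ‖x‖
        set q := ‖x - y‖
        have h1 : B * ‖y‖ ^ 2 ≤ B * (p + q) ^ 2 := by gcongr
        -- Completing the square absorbs the cross term `2 * B * p * q` at the cost of half the
        -- spare decay `δ`.
        have h2 : 0 ≤ (2 * B * p - δ * q) ^ 2 / (2 * δ) := by positivity
        have h3 : (2 * B * p - δ * q) ^ 2 / (2 * δ)
            = 2 * B ^ 2 / δ * p ^ 2 - 2 * B * p * q + δ / 2 * q ^ 2 := by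
          field_simp
          ring
        have h4 : κ = δ + B := by rw [hδ]; ring
        rw [h4]
        nlinarith
    _ = _ := by rw [Real.exp_add]; ring

/-- Part of the Gaussian decay pays for the quadratic factor produced by differentiating in the
exponent. -/
theorem sq_mul_exp_neg_le {κ η r : ℝ} (h : η < κ) :
    r ^ 2 * Real.exp (-κ * r ^ 2) ≤ 1 / (κ - η) * Real.exp (-η * r ^ 2) := by
  have hd : 0 < κ - η := by linarith
  have h1 : (κ - η) * r ^ 2 ≤ Real.exp ((κ - η) * r ^ 2) := by
    linarith [Real.add_one_le_exp ((κ - η) * r ^ 2)]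
  have h2 : Real.exp (-η * r ^ 2) = Real.exp ((κ - η) * r ^ 2) * Real.exp (-κ * r ^ 2) := by
    rw [← Real.exp_add]; ring_nf
  rw [h2, ← mul_assoc]
  gcongr
  rw [one_div, ← div_eq_inv_mul, le_div_iff₀ hd]
  linarith

theorem differentiableAt_integral_mul_exp {f : 𝔼 → ℝ} (hf : Continuous f) {B C κ : ℝ}
    (hB : 0 < B) (hC : 0 ≤ C) (hfb : ∀ y, |f y| ≤ C * Real.exp (B * ‖y‖ ^ 2)) (hκ : B < κ)
    (x : 𝔼) :
    DifferentiableAt ℝ (fun k => ∫ y, f y * Real.exp (-k * ‖x - y‖ ^ 2)) κ := by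
  -- With `B < η < θ < κ`, the derivative is dominated uniformly for `k > θ` by a Gaussian of rate
  -- `η`, which is still integrable against `f`.
  obtain ⟨η, hη, hηκ⟩ := exists_between hκ
  obtain ⟨θ, hθ, hθκ⟩ := exists_between hηκ
  have hint := (integrable_mul_exp_neg_mul_sq_norm_sub hf hB hC hfb hη x).norm.const_mul (1 / (θ - η))
  refine (hasDerivAt_integral_of_dominated_loc_of_deriv_le (s := Ioi θ) (Ioi_mem_nhds hθκ)
    (F' := fun k y => f y * (-‖x - y‖ ^ 2 * Real.exp (-k * ‖x - y‖ ^ 2)))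
    (Eventually.of_forall fun k => by fun_prop)
    (integrable_mul_exp_neg_mul_sq_norm_sub hf hB hC hfb hκ x) (by fun_prop)
    (Eventually.of_forall fun y k hk => ?_) hint
    (Eventually.of_forall fun y k _ => ?_)).2.differentiableAt
  · have hk : θ < k := hk
    rw [norm_mul, norm_mul, norm_mul, norm_neg, Real.norm_of_nonneg (Real.exp_pos _).le,
      Real.norm_of_nonneg (Real.exp_pos _).le, Real.norm_of_nonneg (sq_nonneg _)]
    calc ‖f y‖ * (‖x - y‖ ^ 2 * Real.exp (-k * ‖x - y‖ ^ 2))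
        ≤ ‖f y‖ * (‖x - y‖ ^ 2 * Real.exp (-θ * ‖x - y‖ ^ 2)) := by gcongr
      _ ≤ ‖f y‖ * (1 / (θ - η) * Real.exp (-η * ‖x - y‖ ^ 2)) := by
          gcongr ‖f y‖ * ?_
          exact sq_mul_exp_neg_le hθ
      _ = _ := by ring
  · have h1 : HasDerivAt (fun k : ℝ => -k * ‖x - y‖ ^ 2) (-1 * ‖x - y‖ ^ 2) k :=
      (hasDerivAt_id k).neg.mul_const _
    have h2 := h1.exp.const_mul (f y)
    exact h2.congr_deriv (by ring)

theorem lt_one_div_four_mul {B t : ℝ} (hB : 0 < B) (ht : t ∈ Ioo (0 : ℝ) (1 / (4 * B))) :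
    B < 1 / (4 * t) := by
  have h1 := ht.1
  have h2 := ht.2
  rw [lt_div_iff₀ (by positivity)] at h2 ⊢
  linarith

theorem integrable_mul_heatKernel {f : 𝔼 → ℝ} (hf : Continuous f) {B C t : ℝ}
    (hB : 0 < B) (hC : 0 ≤ C) (hfb : ∀ y, |f y| ≤ C * Real.exp (B * ‖y‖ ^ 2))
    (ht : t ∈ Ioo (0 : ℝ) (1 / (4 * B))) (x : 𝔼) :
    Integrable fun y => f y * heatKernel (x - y) t := by
  have h := (integrable_mul_exp_neg_mul_sq_norm_sub hf hB hC hfb (lt_one_div_four_mul hB ht) x).const_mul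
    (1 / (4 * Real.pi * t) ^ ((N : ℝ) / 2))
  refine h.congr (Eventually.of_forall fun y => ?_)
  simp only [heatKernel_eq]
  ring

theorem integrable_add_mul_heatKernel {f : 𝔼 → ℝ} (hf : Continuous f) {B C t : ℝ}
    (hB : 0 < B) (hC : 0 ≤ C) (hfb : ∀ y, |f y| ≤ C * Real.exp (B * ‖y‖ ^ 2))
    (ht : t ∈ Ioo (0 : ℝ) (1 / (4 * B))) (x : 𝔼) :
    Integrable fun w => f (x + w) * heatKernel w t := by
  have h := (integrable_mul_heatKernel hf hB hC hfb ht x).comp_add_left x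
  refine h.congr (Eventually.of_forall fun w => ?_)
  simp only
  rw [← heatKernel_neg w]
  congr 2
  abel

theorem integrable_sub_mul_heatKernel {f : 𝔼 → ℝ} (hf : Continuous f) {B C t : ℝ}
    (hB : 0 < B) (hC : 0 ≤ C) (hfb : ∀ y, |f y| ≤ C * Real.exp (B * ‖y‖ ^ 2))
    (ht : t ∈ Ioo (0 : ℝ) (1 / (4 * B))) (x : 𝔼) :
    Integrable fun w => f (x - w) * heatKernel w t := by
  have h := (integrable_mul_heatKernel hf hB hC hfb ht x).comp_sub_left x
  simpa using h

theorem differentiableAt_canonicalSolution {f : 𝔼 → ℝ} (hf : Continuous f) {B C t : ℝ}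
    (hB : 0 < B) (hC : 0 ≤ C) (hfb : ∀ y, |f y| ≤ C * Real.exp (B * ‖y‖ ^ 2))
    (ht : t ∈ Ioo (0 : ℝ) (1 / (4 * B))) (x : 𝔼) :
    DifferentiableAt ℝ (canonicalSolution f x) t := by
  have ht0 : 0 < t := ht.1
  have hG := differentiableAt_integral_mul_exp hf hB hC hfb (lt_one_div_four_mul hB ht) x
  have hk : DifferentiableAt ℝ (fun s : ℝ => 1 / (4 * s)) t :=
    (differentiableAt_const _).div (by fun_prop) (by positivity)
  have hc : DifferentiableAt ℝ (fun s : ℝ => 1 / (4 * Real.pi * s) ^ ((N : ℝ) / 2)) t :=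
    (differentiableAt_const _).div
      (DifferentiableAt.rpow_const (by fun_prop) (Or.inl (by positivity))) (by positivity)
  have hcomp := DifferentiableAt.comp t
    (g := fun k => ∫ y, f y * Real.exp (-k * ‖x - y‖ ^ 2)) (f := fun s : ℝ => 1 / (4 * s)) hG hk
  refine (hc.mul hcomp).congr_of_eventuallyEq ?_
  filter_upwards [lt_mem_nhds ht0] with s hs
  rw [canonicalSolution, if_neg hs.ne']
  simp only [Pi.mul_apply, Function.comp_apply, heatKernel_eq]
  rw [← integral_const_mul]
  congr 1
  ext y
  ring

/-- A continuous nonnegative function with vanishing heat average is zero. -/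
theorem eq_zero_of_integral_mul_heatKernel_eq_zero {f : 𝔼 → ℝ} (hf : Continuous f)
    (h0 : ∀ x, 0 ≤ f x) {t : ℝ} (ht : 0 < t) (hi : Integrable fun w => f w * heatKernel w t)
    (h : ∫ w, f w * heatKernel w t = 0) (x : 𝔼) : f x = 0 := by
  rw [integral_eq_zero_iff_of_nonneg (fun w => mul_nonneg (h0 w) (heatKernel_pos ht w).le) hi] at h
  have h1 : f =ᵐ[volume] fun _ => 0 := by
    filter_upwards [h] with w hw
    exact (mul_eq_zero.1 hw).resolve_right (heatKernel_pos ht w).ne'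
  exact congrFun ((Continuous.ae_eq_iff_eq volume hf continuous_const).1 h1) x

/-- A function vanishing at `a` and nonnegative to the right of `a` has nonnegative derivative at `a`. -/
theorem HasDerivAt.nonneg_of_right {H : ℝ → ℝ} {d a b : ℝ} (h : HasDerivAt H d a) (hab : a < b)
    (h0 : H a = 0) (hn : ∀ s ∈ Ioo a b, 0 ≤ H s) : 0 ≤ d := by
  have h1 := (hasDerivWithinAt_iff_tendsto_slope' self_notMem_Ioi).1
    (h.hasDerivWithinAt (s := Ioi a))
  refine ge_of_tendsto h1 ?_
  filter_upwards [Ioo_mem_nhdsGT hab] with s hs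
  rw [slope_def_field, h0, sub_zero]
  exact div_nonneg (hn s hs) (by linarith [hs.1])

end HeatKernel

/-! ### Convexity, ruledness and strict convexity of the solution. -/

section CanonicalSolution

variable {N : ℕ}

local notation "𝔼" => EuclideanSpace ℝ (Fin N)

variable {f : EuclideanSpace ℝ (Fin N) → ℝ} {B C t : ℝ}

theorem integrable_jensen_gap (hf : Continuous f) (hB : 0 < B) (hC : 0 ≤ C)
    (hfb : ∀ y, |f y| ≤ C * Real.exp (B * ‖y‖ ^ 2)) (ht : t ∈ Ioo (0 : ℝ) (1 / (4 * B)))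
    (x y z : 𝔼) (a b : ℝ) :
    Integrable (fun w => (a * f (x + w) + b * f (y + w) - f (z + w)) * heatKernel w t) ∧
      ∫ w, (a * f (x + w) + b * f (y + w) - f (z + w)) * heatKernel w t =
        a * canonicalSolution f x t + b * canonicalSolution f y t - canonicalSolution f z t := by
  have hx := (integrable_add_mul_heatKernel hf hB hC hfb ht x).const_mul a
  have hy := (integrable_add_mul_heatKernel hf hB hC hfb ht y).const_mul b
  have hz := integrable_add_mul_heatKernel hf hB hC hfb ht z
  have heq : (fun w => (a * f (x + w) + b * f (y + w) - f (z + w)) * heatKernel w t) = fun w =>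
      a * (f (x + w) * heatKernel w t) + b * (f (y + w) * heatKernel w t)
        - f (z + w) * heatKernel w t := by
    ext w
    ring
  rw [heq]
  refine ⟨(hx.add hy).sub hz, ?_⟩
  rw [integral_sub (by exact hx.add hy) hz, integral_add hx hy, integral_const_mul, integral_const_mul,
    canonicalSolution_eq_integral_add f x ht.1, canonicalSolution_eq_integral_add f y ht.1,
    canonicalSolution_eq_integral_add f z ht.1]

theorem ConvexOn.jensen_gap_nonneg (hconv : ConvexOn ℝ univ f) (x y : 𝔼) {a b : ℝ} (ha : 0 ≤ a)
    (hb : 0 ≤ b) (hab : a + b = 1) (w : 𝔼) :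
    0 ≤ a * f (x + w) + b * f (y + w) - f (a • x + b • y + w) := by
  have := hconv.2 (mem_univ (x + w)) (mem_univ (y + w)) ha hb hab
  rw [show a • (x + w) + b • (y + w) = a • x + b • y + (a + b) • w by module, hab,
    one_smul] at this
  simp only [smul_eq_mul] at this
  linarith

theorem ConvexOn.convexOn_canonicalSolution (hconv : ConvexOn ℝ univ f) (hf : Continuous f)
    (hB : 0 < B) (hC : 0 ≤ C) (hfb : ∀ y, |f y| ≤ C * Real.exp (B * ‖y‖ ^ 2))
    (ht : t ∈ Ioo (0 : ℝ) (1 / (4 * B))) :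
    ConvexOn ℝ univ (fun x => canonicalSolution f x t) := by
  refine ⟨convex_univ, fun x _ y _ a b ha hb hab => ?_⟩
  have h := (integrable_jensen_gap hf hB hC hfb ht x y (a • x + b • y) a b).2
  have h1 : 0 ≤ ∫ w, (a * f (x + w) + b * f (y + w) - f (a • x + b • y + w)) * heatKernel w t :=
    integral_nonneg fun w =>
      mul_nonneg (hconv.jensen_gap_nonneg x y ha hb hab w) (heatKernel_pos ht.1 w).le
  simp only [smul_eq_mul]
  linarith

theorem IsRuled.isRuled_canonicalSolution {ξ : 𝔼} (h : IsRuled ξ f) (hf : Continuous f)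
    (hB : 0 < B) (hC : 0 ≤ C) (hfb : ∀ y, |f y| ≤ C * Real.exp (B * ‖y‖ ^ 2))
    (ht : t ∈ Ioo (0 : ℝ) (1 / (4 * B))) :
    IsRuled ξ (fun x => canonicalSolution f x t) := by
  intro x μ
  have h1 := (integrable_jensen_gap hf hB hC hfb ht (x + μ • ξ) (x - μ • ξ) x (1 / 2) (1 / 2)).2
  have h2 : ∀ w, 1 / 2 * f (x + μ • ξ + w) + 1 / 2 * f (x - μ • ξ + w) - f (x + w) = 0 := by
    intro w
    have := h (x + w) μ
    rw [add_right_comm x, sub_add_eq_add_sub]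
    linarith
  simp only [h2, zero_mul, integral_zero] at h1
  linarith

theorem ConvexOn.strictConvexOn_canonicalSolution (hconv : ConvexOn ℝ univ f) (hf : Continuous f)
    (hB : 0 < B) (hC : 0 ≤ C) (hfb : ∀ y, |f y| ≤ C * Real.exp (B * ‖y‖ ^ 2))
    (hr : ¬ ∃ ξ, ξ ≠ 0 ∧ IsRuled ξ f) (ht : t ∈ Ioo (0 : ℝ) (1 / (4 * B))) :
    StrictConvexOn ℝ univ (fun x => canonicalSolution f x t) := by
  refine ⟨convex_univ, fun x _ y _ hxy a b ha hb hab => ?_⟩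
  by_contra hlt
  have hle := (hconv.convexOn_canonicalSolution hf hB hC hfb ht).2 (mem_univ x) (mem_univ y)
    ha.le hb.le hab
  obtain ⟨hi, h⟩ := integrable_jensen_gap hf hB hC hfb ht x y (a • x + b • y) a b
  simp only [smul_eq_mul, not_lt] at hle hlt
  have hzero := eq_zero_of_integral_mul_heatKernel_eq_zero (by fun_prop)
    (hconv.jensen_gap_nonneg x y ha.le hb.le hab) ht.1 hi (by linarith)
  refine hr ⟨x - y, sub_ne_zero.2 hxy, hconv.isRuled_of_jensen_eq ha hb hab fun p => ?_⟩
  -- This translation moves the convex combination to the arbitrary point `p`.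
  have hp := hzero (p - (a • x + b • y))
  obtain rfl : b = 1 - a := by linarith
  rw [show x + (p - (a • x + (1 - a) • y)) = p + (1 - a) • (x - y) by module,
    show y + (p - (a • x + (1 - a) • y)) = p - a • (x - y) by module, add_sub_cancel] at hp
  linarith

/-! ### Monotonicity in time through the symmetrised increment. -/

theorem integrable_symm_gap (hf : Continuous f) (hB : 0 < B) (hC : 0 ≤ C)
    (hfb : ∀ y, |f y| ≤ C * Real.exp (B * ‖y‖ ^ 2)) (ht : t ∈ Ioo (0 : ℝ) (1 / (4 * B)))
    (x : 𝔼) :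
    Integrable (fun w => ((f (x + w) + f (x - w)) / 2 - f x) * heatKernel w t) ∧
      ∫ w, ((f (x + w) + f (x - w)) / 2 - f x) * heatKernel w t =
        canonicalSolution f x t - f x := by
  have hp := (integrable_add_mul_heatKernel hf hB hC hfb ht x).const_mul (1 / 2)
  have hm := (integrable_sub_mul_heatKernel hf hB hC hfb ht x).const_mul (1 / 2)
  have hk := (integrable_heatKernel (N := N) ht.1).const_mul (f x)
  have heq : (fun w => ((f (x + w) + f (x - w)) / 2 - f x) * heatKernel w t) = fun w =>
      1 / 2 * (f (x + w) * heatKernel w t) + 1 / 2 * (f (x - w) * heatKernel w t)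
        - f x * heatKernel w t := by
    ext w
    ring
  rw [heq]
  refine ⟨(hp.add hm).sub hk, ?_⟩
  rw [integral_sub (by exact hp.add hm) hk, integral_add hp hm, integral_const_mul, integral_const_mul,
    integral_const_mul, integral_heatKernel ht.1, ← canonicalSolution_eq_integral_add f x ht.1,
    ← canonicalSolution_eq_integral_sub f x ht.1]
  ring

theorem ConvexOn.symm_gap_nonneg (hconv : ConvexOn ℝ univ f) (x w : 𝔼) :
    0 ≤ (f (x + w) + f (x - w)) / 2 - f x := by
  have := hconv.jensen_gap_nonneg w (-w) (by norm_num : (0 : ℝ) ≤ 1 / 2)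
    (by norm_num : (0 : ℝ) ≤ 1 / 2) (by norm_num) x
  rw [show (1 / 2 : ℝ) • w + (1 / 2 : ℝ) • -w + x = x by module, add_comm w, add_comm (-w),
    ← sub_eq_add_neg] at this
  linarith

theorem ConvexOn.mul_symm_gap_le (hconv : ConvexOn ℝ univ f) (x w : 𝔼) {s : ℝ} (hs : 1 ≤ s) :
    s * ((f (x + w) + f (x - w)) / 2 - f x) ≤ (f (x + s • w) + f (x - s • w)) / 2 - f x := by
  have hs0 : 0 < s := by linarith
  -- Secant slopes from `x` increase along the ray: `x + v` is the convex combination of `x + s • v`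
  -- and `x` with weight `s⁻¹`.
  have key : ∀ v : 𝔼, s * (f (x + v) - f x) ≤ f (x + s • v) - f x := fun v => by
    have h := hconv.2 (mem_univ (x + s • v)) (mem_univ x) (inv_nonneg.2 hs0.le)
      (sub_nonneg.2 (inv_le_one_of_one_le₀ hs)) (by ring)
    rw [show s⁻¹ • (x + s • v) + (1 - s⁻¹) • x = x + (s⁻¹ * s) • v by module,
      inv_mul_cancel₀ hs0.ne', one_smul] at h
    simp only [smul_eq_mul] at h
    have h' := mul_le_mul_of_nonneg_left h hs0.le
    have : s * (s⁻¹ * f (x + s • v) + (1 - s⁻¹) * f x) = f (x + s • v) + (s - 1) * f x := by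
      field_simp
    linarith
  have h1 := key w
  have h2 := key (-w)
  rw [smul_neg, ← sub_eq_add_neg, ← sub_eq_add_neg] at h2
  linarith

/-- The increment of the canonical solution of convex data grows at least linearly under parabolic
scaling of time. -/
theorem ConvexOn.mul_increment_le (hconv : ConvexOn ℝ univ f) (hf : Continuous f)
    (hB : 0 < B) (hC : 0 ≤ C) (hfb : ∀ y, |f y| ≤ C * Real.exp (B * ‖y‖ ^ 2))
    (ht : t ∈ Ioo (0 : ℝ) (1 / (4 * B))) (x : 𝔼) {s : ℝ} (hs : 1 ≤ s)
    (hts : t * s ^ 2 < 1 / (4 * B)) :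
    s * (canonicalSolution f x t - f x) ≤ canonicalSolution f x (t * s ^ 2) - f x := by
  have hs0 : 0 < s := by linarith
  have ht0 : 0 < t := ht.1
  obtain ⟨hi, h⟩ := integrable_symm_gap hf hB hC hfb ht x
  obtain ⟨hi', h'⟩ := integrable_symm_gap hf hB hC hfb ⟨by positivity, hts⟩ x
  rw [← h, ← h', integral_mul_heatKernel_scale (fun w => (f (x + w) + f (x - w)) / 2 - f x) hs0 ht0,
    ← integral_const_mul]
  refine integral_mono (hi.const_mul s) (integrable_mul_heatKernel_scale hs0 ht0 hi') fun w => ?_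
  simp only
  rw [← mul_assoc]
  exact mul_le_mul_of_nonneg_right (hconv.mul_symm_gap_le x w hs) (heatKernel_pos ht0 w).le

theorem ConvexOn.increment_nonneg (hconv : ConvexOn ℝ univ f) (hf : Continuous f)
    (hB : 0 < B) (hC : 0 ≤ C) (hfb : ∀ y, |f y| ≤ C * Real.exp (B * ‖y‖ ^ 2))
    (ht : t ∈ Ioo (0 : ℝ) (1 / (4 * B))) (x : 𝔼) : 0 ≤ canonicalSolution f x t - f x := by
  rw [← (integrable_symm_gap hf hB hC hfb ht x).2]
  exact integral_nonneg fun w => mul_nonneg (hconv.symm_gap_nonneg x w) (heatKernel_pos ht.1 w).le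

/-- The scaling inequality is an equality at `s = 1`, so its right derivative there is nonnegative;
the factor `2 * t` is the derivative of `t * s ^ 2`. -/
theorem ConvexOn.increment_le_deriv (hconv : ConvexOn ℝ univ f) (hf : Continuous f)
    (hB : 0 < B) (hC : 0 ≤ C) (hfb : ∀ y, |f y| ≤ C * Real.exp (B * ‖y‖ ^ 2))
    (ht : t ∈ Ioo (0 : ℝ) (1 / (4 * B))) (x : 𝔼) :
    canonicalSolution f x t - f x ≤ 2 * t * deriv (canonicalSolution f x) t := by
  have ht0 : 0 < t := ht.1
  set T := 1 / (4 * B)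
  have hd := (differentiableAt_canonicalSolution hf hB hC hfb ht x).hasDerivAt
  have hsq : HasDerivAt (fun s : ℝ => t * s ^ 2) (2 * t) 1 := by
    have := (hasDerivAt_pow 2 (1 : ℝ)).const_mul t
    exact this.congr_deriv (by norm_num [mul_comm])
  have hcomp : HasDerivAt (fun s : ℝ => canonicalSolution f x (t * s ^ 2))
      (deriv (canonicalSolution f x) t * (2 * t)) 1 :=
    HasDerivAt.comp 1 (h₂ := canonicalSolution f x) (by simpa using hd) hsq
  have hH : HasDerivAt (fun s : ℝ => canonicalSolution f x (t * s ^ 2) - f x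
      - s * (canonicalSolution f x t - f x))
      (deriv (canonicalSolution f x) t * (2 * t) - 1 * (canonicalSolution f x t - f x)) 1 :=
    (hcomp.sub_const _).sub ((hasDerivAt_id (1 : ℝ)).mul_const _)
  have hev : ∀ᶠ s in 𝓝 (1 : ℝ), t * s ^ 2 < T :=
    hsq.continuousAt.eventually_lt_const (by simpa using ht.2)
  obtain ⟨b, hb, hb'⟩ := (mem_nhdsGT_iff_exists_Ioo_subset (a := (1 : ℝ))).1
    (mem_nhdsWithin_of_mem_nhds hev)
  have := hH.nonneg_of_right (b := b) hb (by simp) fun s hs => sub_nonneg.2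
    (hconv.mul_increment_le hf hB hC hfb ht x hs.1.le (hb' hs))
  linarith

/-- The canonical solution with affine datum is stationary. -/
theorem IsAffine.canonicalSolution_eq (h : IsAffine f) (hf : Continuous f) (hB : 0 < B)
    (hC : 0 ≤ C) (hfb : ∀ y, |f y| ≤ C * Real.exp (B * ‖y‖ ^ 2))
    (ht : t ∈ Ioo (0 : ℝ) (1 / (4 * B))) (x : 𝔼) : canonicalSolution f x t = f x := by
  obtain ⟨a, b, hab⟩ := h
  have h0 : ∀ w, (f (x + w) + f (x - w)) / 2 - f x = 0 := fun w => by
    rw [hab, hab, hab, inner_add_right, inner_sub_right]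
    ring
  have := (integrable_symm_gap hf hB hC hfb ht x).2
  simp only [h0, zero_mul, integral_zero] at this
  linarith

/-- The increment is squeezed between `0` and `2 * t * u_t = 0`, so the symmetrised gap at the
single point `x` vanishes identically. -/
theorem ConvexOn.isAffine_of_deriv_eq_zero (hconv : ConvexOn ℝ univ f) (hf : Continuous f)
    (hB : 0 < B) (hC : 0 ≤ C) (hfb : ∀ y, |f y| ≤ C * Real.exp (B * ‖y‖ ^ 2))
    (ht : t ∈ Ioo (0 : ℝ) (1 / (4 * B))) {x : 𝔼}
    (h : deriv (canonicalSolution f x) t = 0) : IsAffine f := by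
  obtain ⟨hi, hs⟩ := integrable_symm_gap hf hB hC hfb ht x
  have h1 := hconv.increment_le_deriv hf hB hC hfb ht x
  have h2 := hconv.increment_nonneg hf hB hC hfb ht x
  rw [h, mul_zero] at h1
  have hz := eq_zero_of_integral_mul_heatKernel_eq_zero (by fun_prop) (hconv.symm_gap_nonneg x)
    ht.1 hi (by linarith)
  exact hconv.isAffine_of_symm hf fun z => by linarith [hz z]

end CanonicalSolution

/-! ### The main theorem. -/

theorem theorem4p7 (N : ℕ) (hN : 1 ≤ N) (u₀ : EuclideanSpace ℝ (Fin N) → ℝ)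
    (hcont : Continuous u₀) (hconv : ConvexOn ℝ univ u₀)
    (A B : ℝ) (hA : 0 < A) (hB : 0 < B)
    (hgrowth : ∀ x, u₀ x ≤ A * Real.exp (B * ‖x‖ ^ 2)) :
    -- the integral defining the canonical solution converges for `0 < t < T = 1 / (4 B)`
    (∀ x, ∀ t ∈ Ioo (0 : ℝ) (1 / (4 * B)), Integrable (fun y => u₀ y * heatKernel (x - y) t)) ∧
    -- convexity
    (∀ t ∈ Ioo (0 : ℝ) (1 / (4 * B)), ConvexOn ℝ univ (fun x => canonicalSolution u₀ x t)) ∧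
    -- ruled in the same direction, or strictly convex
    (∀ ξ, ξ ≠ 0 → IsRuled ξ u₀ →
      ∀ t ∈ Ioo (0 : ℝ) (1 / (4 * B)), IsRuled ξ (fun x => canonicalSolution u₀ x t)) ∧
    ((¬ ∃ ξ, ξ ≠ 0 ∧ IsRuled ξ u₀) →
      ∀ t ∈ Ioo (0 : ℝ) (1 / (4 * B)),
        StrictConvexOn ℝ univ (fun x => canonicalSolution u₀ x t)) ∧
    -- the time derivative exists and is nonnegative
    (∀ x, ∀ t ∈ Ioo (0 : ℝ) (1 / (4 * B)),
      DifferentiableAt ℝ (canonicalSolution u₀ x) t ∧ 0 ≤ deriv (canonicalSolution u₀ x) t) ∧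
    -- it vanishes somewhere exactly in the trivial case
    ((∃ x, ∃ t ∈ Ioo (0 : ℝ) (1 / (4 * B)), deriv (canonicalSolution u₀ x) t = 0) ↔
      IsAffine u₀ ∧
        ∀ x, ∀ t ∈ Ioo (0 : ℝ) (1 / (4 * B)), canonicalSolution u₀ x t = u₀ x) := by
  obtain ⟨C, hC, hb⟩ : ∃ C, 0 ≤ C ∧ ∀ y, |u₀ y| ≤ C * Real.exp (B * ‖y‖ ^ 2) :=
    ⟨2 * |u₀ 0| + A, by positivity, hconv.abs_le_of_le_exp hB.le hgrowth⟩
  refine ⟨fun x t ht => integrable_mul_heatKernel hcont hB hC hb ht x,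
    fun t ht => hconv.convexOn_canonicalSolution hcont hB hC hb ht,
    fun ξ _ hr t ht => hr.isRuled_canonicalSolution hcont hB hC hb ht,
    fun hr t ht => hconv.strictConvexOn_canonicalSolution hcont hB hC hb hr ht,
    fun x t ht => ⟨differentiableAt_canonicalSolution hcont hB hC hb ht x, ?_⟩, ?_, ?_⟩
  · have h1 := hconv.increment_le_deriv hcont hB hC hb ht x
    have h2 := hconv.increment_nonneg hcont hB hC hb ht x
    exact nonneg_of_mul_nonneg_right (h2.trans h1) (mul_pos two_pos ht.1)
  · rintro ⟨x, t, ht, h⟩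
    have haff := hconv.isAffine_of_deriv_eq_zero hcont hB hC hb ht h
    exact ⟨haff, fun y s hs => haff.canonicalSolution_eq hcont hB hC hb hs y⟩
  · rintro ⟨-, h⟩
    obtain ⟨t, ht⟩ : (Ioo (0 : ℝ) (1 / (4 * B))).Nonempty := nonempty_Ioo.2 (by positivity)
    refine ⟨0, t, ht, ?_⟩
    have hev : canonicalSolution u₀ 0 =ᶠ[𝓝 t] fun _ => u₀ 0 := by
      filter_upwards [Ioo_mem_nhds ht.1 ht.2] with s hs
      exact h 0 s hs
    rw [hev.deriv_eq, deriv_const]
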